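/- Let $k$ be a commutative domain, let $K$ be an abstract simplicial complex on vertices $x_1,\dots,x_n$ (with $\varnothing$ counted as a face; a vertex need not be a face), and let $R=k[x_1,\dots,x_n]/I_K$ be its Stanley–Reisner ring, where $I_K$ is the ideal generated by the square-free monomials $\prod_{i\in\sigma}x_i$ over all $\sigma\notin K$. Let $D(R)=\bigcup_{m\ge 0}D^m(R)\subseteq\operatorname{End}_k(R)$ be the ring of $k$-linear differential operators on $R$, where $D^0(R)=R$ acts by multiplication and $D^{m}(R)=\{\varphi\in\operatorname{End}_k(R): [\varphi,r]\in D^{m-1}(R)\text{ for all }r\in R\}$ for $m>0$. For $\tau\subseteq\{1,\dots,n\}$ write $x_\tau=\prod_{i\in\tau}x_i$ (a reduced monomial), regarded as an element of $D(R)$, and write $\langle\,\cdot\,\rangle$ for the two-sided ideal of $D(R)$ generated by a set. 1. If $k$ is a field, then every proper two-sided ideal of $D(R)$ is generated by a set of reduced monomials $x_\tau$. 2. For an arbitrary commutative domain $k$, every proper two-sided ideal of $D(R)$ is generated by a set of constant multiples $c\,x_\tau$ (with $c\in k$) of reduced monomials. 3. Let $k$ be an arbitrary commutative domain (of any characteristic).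 For $a,b\in\mathbb N^n$ let $x^a\partial^{(b)}$ be the operator $x^m\mapsto\prod_i\binom{m_i}{b_i}\,x^{m-b+a}$ on $k[x_1,\dots,x_n]$ (a monomial with some $m_i<b_i$ is sent to $0$). If $x^a\partial^{(b)}$ maps $I_K$ into itself and the endomorphism that it induces on $R$, again denoted $x^a\partial^{(b)}$, lies in $D(R)$, then $$\langle x^a\partial^{(b)}\rangle=\Big\langle \prod_{i:\,a_i\neq 0}x_i\Big\rangle .$$ -/

import Mathlib

/-- The face ideal `I_K` of an abstract simplicial complex `K` on the vertices `x_1, …, x_n`: the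
ideal of `k[x_1, …, x_n]` generated by the square-free monomials of the non-faces of `K`. (In
Mathlib the faces of `K` are nonempty; the empty set is tacitly a face, so the non-faces are the
nonempty finite sets that do not belong to `K`. Vertices are not required to be faces.) -/
noncomputable def faceIdeal (k : Type*) [CommRing k] {n : ℕ} (K : PreAbstractSimplicialComplex (Fin n)) :
    Ideal (MvPolynomial (Fin n) k) :=
  Ideal.span {f | ∃ σ : Finset (Fin n), σ.Nonempty ∧ σ ∉ K ∧ f = ∏ i ∈ σ, MvPolynomial.X i}

/-- The Stanley-Reisner ring (face ring) `R_K = k[x_1, …, x_n] / I_K`. -/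
abbrev FaceRing (k : Type*) [CommRing k] {n : ℕ} (K : PreAbstractSimplicialComplex (Fin n)) :
    Type _ :=
  MvPolynomial (Fin n) k ⧸ faceIdeal k K

section DifferentialOperators

/-- The `k`-linear differential operators of order at most `m` on `R`:
`D⁰ = R`, acting by multiplication, and `D^{m+1} = {φ ∈ End_k(R) | [φ, r] ∈ D^m for all r ∈ R}`. -/
def IsDiffOpOfOrder (k R : Type*) [CommRing k] [CommRing R] [Algebra k R] :
    ℕ → Module.End k R → Prop
  | 0, φ => ∃ r : R, φ = LinearMap.mulLeft k r
  | m + 1, φ => ∀ r : R,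
      IsDiffOpOfOrder k R m (φ * LinearMap.mulLeft k r - LinearMap.mulLeft k r * φ)

variable {k R : Type*} [CommRing k] [CommRing R] [Algebra k R]

theorem IsDiffOpOfOrder.add {m : ℕ} {φ ψ : Module.End k R} (hφ : IsDiffOpOfOrder k R m φ)
    (hψ : IsDiffOpOfOrder k R m ψ) : IsDiffOpOfOrder k R m (φ + ψ) := by
  induction m generalizing φ ψ with
  | zero =>
    obtain ⟨r, rfl⟩ := hφ
    obtain ⟨s, rfl⟩ := hψ
    exact ⟨r + s, by ext x; simp [add_mul]⟩
  | succ m ih =>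
    intro r
    have h := ih (hφ r) (hψ r)
    convert h using 1
    noncomm_ring

theorem IsDiffOpOfOrder.zero_mem (m : ℕ) : IsDiffOpOfOrder k R m 0 := by
  induction m with
  | zero => exact ⟨0, by ext x; simp⟩
  | succ m ih => intro r; simpa using ih

theorem IsDiffOpOfOrder.succ {m : ℕ} {φ : Module.End k R} (hφ : IsDiffOpOfOrder k R m φ) :
    IsDiffOpOfOrder k R (m + 1) φ := by
  induction m generalizing φ with
  | zero =>
    obtain ⟨s, rfl⟩ := hφ
    intro r
    exact ⟨0, by ext x; simp [mul_left_comm]⟩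
  | succ m ih => intro r; exact ih (hφ r)

theorem IsDiffOpOfOrder.mono {m m' : ℕ} (h : m ≤ m') {φ : Module.End k R}
    (hφ : IsDiffOpOfOrder k R m φ) : IsDiffOpOfOrder k R m' φ := by
  induction h with
  | refl => exact hφ
  | step _ ih => exact ih.succ

theorem IsDiffOpOfOrder.mul {m m' : ℕ} {φ ψ : Module.End k R} (hφ : IsDiffOpOfOrder k R m φ)
    (hψ : IsDiffOpOfOrder k R m' ψ) : IsDiffOpOfOrder k R (m + m') (φ * ψ) := by
  induction hN : m + m' generalizing m m' φ ψ with
  | zero =>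
    obtain ⟨rfl, rfl⟩ : m = 0 ∧ m' = 0 := by omega
    obtain ⟨r, rfl⟩ := hφ
    obtain ⟨s, rfl⟩ := hψ
    exact ⟨r * s, by ext x; simp⟩
  | succ N ih =>
    intro r
    have e : φ * ψ * LinearMap.mulLeft k r - LinearMap.mulLeft k r * (φ * ψ)
        = φ * (ψ * LinearMap.mulLeft k r - LinearMap.mulLeft k r * ψ)
          + (φ * LinearMap.mulLeft k r - LinearMap.mulLeft k r * φ) * ψ := by
      rw [mul_sub, sub_mul, mul_assoc, mul_assoc, mul_assoc]
      abel
    rw [e]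
    have comm0 : ∀ {χ : Module.End k R}, IsDiffOpOfOrder k R 0 χ →
        χ * LinearMap.mulLeft k r - LinearMap.mulLeft k r * χ = 0 := by
      rintro χ ⟨s, rfl⟩
      ext x
      simp [mul_left_comm]
    refine IsDiffOpOfOrder.add ?_ ?_
    · cases m' with
      | zero => rw [comm0 hψ, mul_zero]; exact IsDiffOpOfOrder.zero_mem N
      | succ m' => exact ih hφ (hψ r) (by omega)
    · cases m with
      | zero => rw [comm0 hφ, zero_mul]; exact IsDiffOpOfOrder.zero_mem N
      | succ m => exact ih (hφ r) hψ (by omega)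

/-- The ring `D_k(R) = ⋃ₘ D_k^m(R)` of `k`-linear differential operators on a commutative
`k`-algebra `R`, as a subalgebra of `End_k(R)`. -/
def diffOps (k R : Type*) [CommRing k] [CommRing R] [Algebra k R] :
    Subalgebra k (Module.End k R) where
  carrier := {φ | ∃ m : ℕ, IsDiffOpOfOrder k R m φ}
  mul_mem' := by
    rintro φ ψ ⟨m, hm⟩ ⟨m', hm'⟩
    exact ⟨m + m', hm.mul hm'⟩
  add_mem' := by
    rintro φ ψ ⟨m, hm⟩ ⟨m', hm'⟩
    exact ⟨max m m', (hm.mono (le_max_left _ _)).add (hm'.mono (le_max_right _ _))⟩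
  algebraMap_mem' := by
    intro c
    exact ⟨0, algebraMap k R c, by ext x; simp [Algebra.smul_def]⟩

/-- An element of `R`, viewed as the differential operator of order zero `f ↦ r * f`. -/
def mulOp (k : Type*) {R : Type*} [CommRing k] [CommRing R] [Algebra k R] (r : R) :
    diffOps k R :=
  ⟨LinearMap.mulLeft k r, 0, r, rfl⟩

end DifferentialOperators

noncomputable section

/-- The reduced (square-free) monomial `x_τ = ∏_{i ∈ τ} x_i`, as an element of `D(R_K)`. -/
def reducedMonomial (k : Type*) [CommRing k] {n : ℕ} (K : PreAbstractSimplicialComplex (Fin n))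
    (τ : Finset (Fin n)) : diffOps k (FaceRing k K) :=
  mulOp k (Ideal.Quotient.mk (faceIdeal k K) (∏ i ∈ τ, MvPolynomial.X i))

/-- The divided power operator `∂^{(b)} = ∏ᵢ (1 / bᵢ!) (∂ / ∂xᵢ)^{bᵢ}` on `k[x_1, …, x_n]`, i.e. the
`k`-linear map `x^m ↦ (∏ᵢ (mᵢ choose bᵢ)) x^{m - b}`. (If some `mᵢ < bᵢ`, the coefficient is
zero.) -/
def dividedPowerOp (k : Type*) [CommRing k] {n : ℕ} (b : Fin n →₀ ℕ) :
    Module.End k (MvPolynomial (Fin n) k) :=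
  (MvPolynomial.basisMonomials (Fin n) k).constr k fun m =>
    MvPolynomial.monomial (m - b) (∏ i, ((m i).choose (b i) : k))

/-- The element `x^a ∂^{(b)}` of the Weyl algebra. -/
def weylMonomial (k : Type*) [CommRing k] {n : ℕ} (a b : Fin n →₀ ℕ) :
    Module.End k (MvPolynomial (Fin n) k) :=
  LinearMap.mulLeft k (MvPolynomial.monomial a 1) * dividedPowerOp k b

/-- The differential operator `θ` on `R_K` is the one given by the operator `P` on the polynomial
ring: `P` descends to the quotient `R_K` and induces `θ` there. -/
def IsInducedBy {k : Type*} [CommRing k] {n : ℕ} {K : PreAbstractSimplicialComplex (Fin n)}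
    (θ : diffOps k (FaceRing k K)) (P : Module.End k (MvPolynomial (Fin n) k)) : Prop :=
  ∀ f : MvPolynomial (Fin n) k,
    (θ : Module.End k (FaceRing k K)) (Ideal.Quotient.mk (faceIdeal k K) f) =
      Ideal.Quotient.mk (faceIdeal k K) (P f)

end

/-!
Write `W a b` for the operator `x^a ∂^(b)` on `k[x_1, …, x_n]` and `D(R)` for the ring of
differential operators on the face ring `R`. The face ideal is spanned by the monomials whose
support is not a face, so `W a b` descends to `R` exactly when the pair `(a, b)` is *admissible*:
whenever `supp a ∪ G` is a face, so is `supp b ∪ G`.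

**The admissible `W a b` span `D(R)`** (`exists_isInducedBy_sum`). If `φ` has order at most `M` and
`s * g = 0`, then `s ^ (M + 1) * φ g = 0`. With `g = x^b` and `s = x_G`, where `supp b ∪ G` is not a
face, this shows that every monomial `x^a` of `φ(x^b)` gives an admissible pair `(a, b)`. An
operator of order at most `M` is determined by its values in degrees at most `M`, so subtracting
`φ(x^b) ∂^(b)`, degree by degree, expresses `φ` through admissible operators.

**Every ideal contains the terms of its elements** (`InducesMem.of_smul_reducedMonomial_mem`). Let
`φ = ∑ c_{ab} W a b` belong to a two-sided ideal `I`. Commutators with the variables lower the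
exponents `b`. Lowering by a `b` of maximal degree leaves multiplication by the polynomial
`∑ c_{ab} x^a`, and the Leibniz rule for `x_i^e ∂_i^(e)` separates its terms, so each `c_{ab} x^a`
belongs to `I`.

**Passing between `c x^a` and `c x_A`, where `A = supp a`**
(`InducesMem.reducedExponent_weylMonomial`). If `c x^a` belongs to `I`, then so does
`c x^a x_A ∂^(t)` for all admissible `t`. For `q ≥ 2` the operator
`x_i^(q-1) ∂_i^(q) x_i^q` is the sum of `x_i^(q-1)` and of left multiples of operators
`x_i^q ∂_i^(l)` with `l > 0`, so exponents can be lowered one at a time, down to `c x_A ∂^(t)`. This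
works in every characteristic, since the coefficient of `x_i^(q-1)` is `1`. Hence `c x^a`,
`c x_A` and `c W a b` generate the same ideal, which gives the statement on principal ideals, and
`I` is generated by the `c x_τ` that it contains.
-/

/-! ### Divided power operators on the polynomial ring -/

section WeylAlgebra

open MvPolynomial Finsupp

variable {k : Type*} [CommRing k] {n : ℕ}

theorem dividedPowerOp_monomial (b m : Fin n →₀ ℕ) (c : k) :
    dividedPowerOp k b (monomial m c) =
      monomial (m - b) (c * ∏ i, ((m i).choose (b i) : k)) := by
  have h : monomial m c = c • (basisMonomials (Fin n) k m) := by
    simp [smul_monomial]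
  rw [h, map_smul, dividedPowerOp, Module.Basis.constr_basis, smul_monomial, smul_eq_mul]

theorem dividedPowerOp_zero : dividedPowerOp k (0 : Fin n →₀ ℕ) = 1 := by
  refine (basisMonomials (Fin n) k).ext fun m => ?_
  simp [dividedPowerOp_monomial]

theorem dividedPowerOp_monomial_eq_zero {b m : Fin n →₀ ℕ} (h : ¬ b ≤ m) (c : k) :
    dividedPowerOp k b (monomial m c) = 0 := by
  obtain ⟨i, hi⟩ : ∃ i, m i < b i := by simpa [Finsupp.le_def] using h
  rw [dividedPowerOp_monomial, Finset.prod_eq_zero (Finset.mem_univ i) (by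
    rw [Nat.choose_eq_zero_of_lt hi, Nat.cast_zero]), mul_zero, monomial_zero]

theorem dividedPowerOp_single_monomial (i : Fin n) (t : ℕ) (m : Fin n →₀ ℕ) (c : k) :
    dividedPowerOp k (single i t) (monomial m c) =
      monomial (m - single i t) (c * ((m i).choose t : k)) := by
  rw [dividedPowerOp_monomial, Finset.prod_eq_single i (fun j _ hj => by
    simp [single_eq_of_ne hj]) (by simp), single_eq_same]

theorem dividedPowerOp_mul (s t : Fin n →₀ ℕ) :
    dividedPowerOp k s * dividedPowerOp k t =
      (∏ i, ((s i + t i).choose (s i) : k)) • dividedPowerOp k (s + t) := by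
  refine (basisMonomials (Fin n) k).ext fun m => ?_
  simp only [coe_basisMonomials, Module.End.mul_apply, LinearMap.smul_apply,
    dividedPowerOp_monomial, smul_monomial, smul_eq_mul, one_mul, ← Finset.prod_mul_distrib]
  congr 1
  · rw [tsub_tsub, add_comm t]
  · refine Finset.prod_congr rfl fun i _ => ?_
    rw [Finsupp.tsub_apply, Finsupp.add_apply]
    norm_cast
    rcases le_or_gt (s i + t i) (m i) with h | h
    · have := Nat.choose_mul (n := m i) (k := s i + t i) (s := t i) (by omega)
      rw [Nat.add_sub_cancel] at this
      rw [← this, mul_comm, Nat.choose_symm_add]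
    · rw [Nat.choose_eq_zero_of_lt h, mul_zero]
      rcases le_or_gt (t i) (m i) with h' | h'
      · rw [Nat.choose_eq_zero_of_lt (show m i - t i < s i by omega), mul_zero]
      · rw [Nat.choose_eq_zero_of_lt h', zero_mul]

theorem dividedPowerOp_single_mul_of_eq_zero {i : Fin n} {b : Fin n →₀ ℕ} (h : b i = 0) (t : ℕ) :
    dividedPowerOp k (single i t) * dividedPowerOp k b = dividedPowerOp k (single i t + b) := by
  rw [dividedPowerOp_mul, Finset.prod_eq_one, one_smul]
  intro j _
  rcases eq_or_ne j i with rfl | hj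
  · simp [h]
  · simp [single_eq_of_ne hj]

/-- The Leibniz rule for the divided powers of one partial derivative. -/
theorem dividedPowerOp_single_leibniz (i : Fin n) (t : ℕ) (p q : MvPolynomial (Fin n) k) :
    dividedPowerOp k (single i t) (p * q) =
      ∑ jl ∈ Finset.HasAntidiagonal.antidiagonal t,
        dividedPowerOp k (single i jl.1) p * dividedPowerOp k (single i jl.2) q := by
  induction p using MvPolynomial.induction_on' with
  | add p p' hp hp' => simp only [add_mul, map_add, hp, hp', Finset.sum_add_distrib]
  | monomial m c =>
  induction q using MvPolynomial.induction_on' with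
  | add p p' hp hp' => simp only [mul_add, map_add, hp, hp', Finset.sum_add_distrib]
  | monomial m' c' =>
    have key : ∀ jl ∈ Finset.HasAntidiagonal.antidiagonal t,
        dividedPowerOp k (single i jl.1) (monomial m c) *
          dividedPowerOp k (single i jl.2) (monomial m' c') =
        monomial (m + m' - single i t)
          (c * c' * (((m i).choose jl.1 * (m' i).choose jl.2 : ℕ) : k)) := by
      rintro ⟨j, l⟩ hjl
      obtain rfl : j + l = t := by simpa using hjl
      simp only [dividedPowerOp_single_monomial, monomial_mul]
      rcases le_or_gt j (m i) with hj | hj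
      · rcases le_or_gt l (m' i) with hl | hl
        · refine congrArg₂ (fun e : Fin n →₀ ℕ => monomial e) ?_ ?_
          · ext x
            rcases eq_or_ne x i with rfl | hx
            · simp; omega
            · simp [single_eq_of_ne hx]
          · push_cast; ring
        · simp [Nat.choose_eq_zero_of_lt hl]
      · simp [Nat.choose_eq_zero_of_lt hj]
    rw [Finset.sum_congr rfl key, monomial_mul, dividedPowerOp_single_monomial, Finsupp.add_apply,
      Nat.add_choose_eq, Nat.cast_sum, Finset.mul_sum, map_sum]

theorem dividedPowerOp_single_mul_mulLeft (i : Fin n) (t : ℕ) (p : MvPolynomial (Fin n) k) :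
    dividedPowerOp k (single i t) * LinearMap.mulLeft k p =
      ∑ jl ∈ Finset.HasAntidiagonal.antidiagonal t,
        LinearMap.mulLeft k (dividedPowerOp k (single i jl.1) p) *
          dividedPowerOp k (single i jl.2) := by
  refine LinearMap.ext fun q => ?_
  simp [dividedPowerOp_single_leibniz, LinearMap.sum_apply]

theorem dividedPowerOp_mul_X_of_eq_zero {b : Fin n →₀ ℕ} {i : Fin n} (h : b i = 0) :
    dividedPowerOp k b * LinearMap.mulLeft k (X i) =
      LinearMap.mulLeft k (X i) * dividedPowerOp k b := by
  refine (basisMonomials (Fin n) k).ext fun m => ?_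
  simp only [coe_basisMonomials, Module.End.mul_apply, LinearMap.mulLeft_apply, X, monomial_mul,
    dividedPowerOp_monomial, one_mul]
  refine congrArg₂ (fun e : Fin n →₀ ℕ => monomial e) ?_ ?_
  · ext x
    rcases eq_or_ne x i with rfl | hx
    · simp [h]
    · simp [single_eq_of_ne hx]
  · refine Finset.prod_congr rfl fun j _ => ?_
    rcases eq_or_ne j i with rfl | hx
    · simp [h]
    · simp [single_eq_of_ne hx]

theorem dividedPowerOp_add_single_mul_X (b : Fin n →₀ ℕ) (i : Fin n) :
    dividedPowerOp k (b + single i 1) * LinearMap.mulLeft k (X i) =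
      LinearMap.mulLeft k (X i) * dividedPowerOp k (b + single i 1) + dividedPowerOp k b := by
  classical
  have hb : b + single i 1 = single i (b i + 1) + b.erase i := by
    ext x
    rcases eq_or_ne x i with rfl | hx
    · simp
    · simp [single_eq_of_ne hx, Finsupp.erase_ne hx]
  have hb' : b = single i (b i) + b.erase i := (single_add_erase i b).symm
  have h0 : (b.erase i) i = 0 := by simp
  have hX : ∀ j, dividedPowerOp k (single i (j + 2)) (X i) = 0 := by
    intro j
    rw [X, dividedPowerOp_single_monomial, single_eq_same,
      Nat.choose_eq_zero_of_lt (by omega)]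
    simp
  have key : dividedPowerOp k (single i (b i + 1)) * LinearMap.mulLeft k (X i) =
      LinearMap.mulLeft k (X i) * dividedPowerOp k (single i (b i + 1)) +
        dividedPowerOp k (single i (b i)) := by
    rw [dividedPowerOp_single_mul_mulLeft, Finset.Nat.antidiagonal_succ, Finset.sum_cons,
      Finset.sum_map]
    congr 1
    · simp [dividedPowerOp_zero]
    · cases b i with
      | zero => simp [X, dividedPowerOp_single_monomial, dividedPowerOp_zero]; rfl
      | succ c =>
        rw [Finset.Nat.antidiagonal_succ, Finset.sum_cons, Finset.sum_map]
        have : dividedPowerOp k (single i 1) (X i : MvPolynomial (Fin n) k) = 1 := by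
          simp [X, dividedPowerOp_single_monomial]
        simp [hX, this, -single_add, ← Module.End.one_eq_id]
  rw [hb, ← dividedPowerOp_single_mul_of_eq_zero h0, mul_assoc, dividedPowerOp_mul_X_of_eq_zero h0,
    ← mul_assoc, key, add_mul, dividedPowerOp_single_mul_of_eq_zero h0, mul_assoc,
    dividedPowerOp_single_mul_of_eq_zero h0, ← hb']

end WeylAlgebra

/-! ### Differential operators -/

section DiffOps

open MvPolynomial Finsupp

variable {k R S : Type*} [CommRing k] [CommRing R] [Algebra k R] [CommRing S] [Algebra k S]

theorem IsDiffOpOfOrder.sum {ι : Type*} {m : ℕ} {s : Finset ι} {φ : ι → Module.End k R}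
    (h : ∀ i ∈ s, IsDiffOpOfOrder k R m (φ i)) : IsDiffOpOfOrder k R m (∑ i ∈ s, φ i) :=
  Finset.sum_induction _ _ (fun _ _ => IsDiffOpOfOrder.add) (.zero_mem m) h

theorem IsDiffOpOfOrder.mulLeft (r : R) : IsDiffOpOfOrder k R 0 (LinearMap.mulLeft k r) := ⟨r, rfl⟩

theorem IsDiffOpOfOrder.mulLeft_mul {m : ℕ} (r : R) {φ : Module.End k R}
    (h : IsDiffOpOfOrder k R m φ) : IsDiffOpOfOrder k R m (LinearMap.mulLeft k r * φ) := by
  simpa using (IsDiffOpOfOrder.mulLeft r).mul h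

theorem IsDiffOpOfOrder.sub {m : ℕ} {φ ψ : Module.End k R} (hφ : IsDiffOpOfOrder k R m φ)
    (hψ : IsDiffOpOfOrder k R m ψ) : IsDiffOpOfOrder k R m (φ - ψ) := by
  have : φ - ψ = φ + LinearMap.mulLeft k (-1 : R) * ψ := by
    ext x; simp [sub_eq_add_neg]
  rw [this]
  exact hφ.add (hψ.mulLeft_mul _)

theorem mulLeft_mul_mulLeft (r s : R) :
    LinearMap.mulLeft k r * LinearMap.mulLeft k s = LinearMap.mulLeft k (r * s) :=
  LinearMap.ext fun t => (mul_assoc r s t).symm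

theorem smul_mulLeft (c : k) (r : R) : c • LinearMap.mulLeft k r = LinearMap.mulLeft k (c • r) :=
  LinearMap.ext fun s => (smul_mul_assoc c r s).symm

theorem IsDiffOpOfOrder.smul {m : ℕ} (c : k) {φ : Module.End k R}
    (h : IsDiffOpOfOrder k R m φ) : IsDiffOpOfOrder k R m (c • φ) := by
  have : c • φ = LinearMap.mulLeft k (algebraMap k R c) * φ := by
    ext x; simp [Algebra.smul_def]
  rw [this]
  exact h.mulLeft_mul _

/-- A differential operator that descends along a surjective homomorphism induces an operator of
at most the same order. -/
theorem IsDiffOpOfOrder.of_semiconj {f : S →ₐ[k] R} (hf : Function.Surjective f) {m : ℕ}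
    {P : Module.End k S} {φ : Module.End k R} (hP : IsDiffOpOfOrder k S m P)
    (h : ∀ s, φ (f s) = f (P s)) : IsDiffOpOfOrder k R m φ := by
  induction m generalizing P φ with
  | zero =>
    obtain ⟨s, rfl⟩ := hP
    refine ⟨f s, LinearMap.ext fun r => ?_⟩
    obtain ⟨t, rfl⟩ := hf r
    simp [h]
  | succ m ih =>
    intro r
    obtain ⟨t, rfl⟩ := hf r
    refine ih (hP t) fun s => ?_
    simp [← map_mul, h]

/-- A differential operator of order `m` sends the annihilator of `s` into that of `s ^ (m + 1)`. -/
theorem IsDiffOpOfOrder.pow_succ_mul_apply_eq_zero {m : ℕ} {φ : Module.End k R}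
    (hφ : IsDiffOpOfOrder k R m φ) {s g : R} (hs : s * g = 0) : s ^ (m + 1) * φ g = 0 := by
  induction m generalizing φ with
  | zero =>
    obtain ⟨r, rfl⟩ := hφ
    simp [mul_left_comm s r, hs]
  | succ m ih =>
    have h := ih (hφ s)
    simpa [hs, pow_succ, mul_assoc] using h

theorem isDiffOpOfOrder_dividedPowerOp_single {n : ℕ} (i : Fin n) (t : ℕ) :
    IsDiffOpOfOrder k (MvPolynomial (Fin n) k) t (dividedPowerOp k (single i t)) := by
  induction t using Nat.strong_induction_on with
  | _ t ih =>
  cases t with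
  | zero => exact ⟨1, by simp [dividedPowerOp_zero]; rfl⟩
  | succ t =>
    intro p
    rw [dividedPowerOp_single_mul_mulLeft, Finset.Nat.antidiagonal_succ, Finset.sum_cons,
      Finset.sum_map]
    simp only [single_zero, dividedPowerOp_zero, Module.End.one_apply, add_sub_cancel_left]
    refine .sum fun jl hjl => .mulLeft_mul _ ?_
    have : jl.1 + jl.2 = t := Finset.HasAntidiagonal.mem_antidiagonal.mp hjl
    exact (ih jl.2 (by omega)).mono (by omega)

theorem isDiffOpOfOrder_dividedPowerOp {n : ℕ} (b : Fin n →₀ ℕ) :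
    IsDiffOpOfOrder k (MvPolynomial (Fin n) k) b.degree (dividedPowerOp k b) := by
  induction b using Finsupp.induction with
  | zero => exact ⟨1, by simp [dividedPowerOp_zero]; rfl⟩
  | single_add i t b hi _ ih =>
    rw [← dividedPowerOp_single_mul_of_eq_zero (by simpa using hi), map_add,
      Finsupp.degree_single]
    exact (isDiffOpOfOrder_dividedPowerOp_single i t).mul ih

end DiffOps

/-! ### Faces and the face ideal -/

section Faces

open MvPolynomial Finsupp

variable {n : ℕ} (K : PreAbstractSimplicialComplex (Fin n))

/-- The faces of `K`, with the empty set counted as a face. -/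
def IsFace (s : Finset (Fin n)) : Prop := s = ∅ ∨ s ∈ K

/-- The pairs of exponents for which `x^a ∂^(b)` preserves the face ideal: whenever
`supp a ∪ G` is a face, so is `supp b ∪ G`. Pairs where `supp a` is not a face are included. -/
def IsAdmissible (a b : Fin n →₀ ℕ) : Prop :=
  ∀ G : Finset (Fin n), IsFace K (a.support ∪ G) → IsFace K (b.support ∪ G)

variable {K}

theorem IsFace.mono {s t : Finset (Fin n)} (ht : IsFace K t) (h : s ⊆ t) : IsFace K s := by
  rcases s.eq_empty_or_nonempty with rfl | hs
  · exact Or.inl rfl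
  · rcases ht with rfl | ht
    · exact Or.inl (Finset.subset_empty.mp h)
    · exact Or.inr ((K.isRelLowerSet_faces ht).2 h hs)

theorem IsAdmissible.of_support_subset {a b : Fin n →₀ ℕ} (h : b.support ⊆ a.support) :
    IsAdmissible K a b := fun _ hG => hG.mono (Finset.union_subset_union_left h)

theorem IsAdmissible.mono {a a' b b' : Fin n →₀ ℕ} (h : IsAdmissible K a b)
    (ha : a.support ⊆ a'.support) (hb : b'.support ⊆ b.support) : IsAdmissible K a' b' :=
  fun G hG => (h G (hG.mono (Finset.union_subset_union_left ha))).mono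
    (Finset.union_subset_union_left hb)

theorem IsAdmissible.add {a b b' : Fin n →₀ ℕ} (h : IsAdmissible K a b)
    (h' : b'.support ⊆ a.support) : IsAdmissible K a (b + b') := by
  classical
  intro G hG
  refine (h (a.support ∪ G) (by rwa [← Finset.union_assoc, Finset.union_self])).mono ?_
  refine Finset.union_subset (Finsupp.support_add.trans (Finset.union_subset ?_ ?_)) ?_
  · exact Finset.subset_union_left
  · exact h'.trans (Finset.subset_union_left.trans Finset.subset_union_right)
  · exact Finset.subset_union_right.trans Finset.subset_union_right

/-- The exponent of the reduced monomial `x_τ`. -/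
noncomputable def reducedExponent (τ : Finset (Fin n)) : Fin n →₀ ℕ := ∑ i ∈ τ, single i 1

theorem reducedExponent_apply (τ : Finset (Fin n)) (i : Fin n) :
    reducedExponent τ i = if i ∈ τ then 1 else 0 := by
  simp [reducedExponent, Finsupp.finsetSum_apply, Finsupp.single_apply]

@[simp]
theorem support_reducedExponent (τ : Finset (Fin n)) : (reducedExponent τ).support = τ := by
  ext i; simp [reducedExponent_apply]

variable {k : Type*} [CommRing k]

theorem prod_X_eq_monomial_reducedExponent (τ : Finset (Fin n)) :
    ∏ i ∈ τ, (X i : MvPolynomial (Fin n) k) = monomial (reducedExponent τ) 1 :=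
  (monomial_sum_one τ fun i => single i 1).symm

/-- The face ideal consists of the polynomials none of whose monomials is supported on a face. -/
theorem mem_faceIdeal {p : MvPolynomial (Fin n) k} :
    p ∈ faceIdeal k K ↔ ∀ m ∈ p.support, ¬ IsFace K m.support := by
  classical
  have h : {f : MvPolynomial (Fin n) k |
        ∃ σ : Finset (Fin n), σ.Nonempty ∧ σ ∉ K ∧ f = ∏ i ∈ σ, X i} =
      (fun s => monomial s (1 : k)) '' (reducedExponent '' {σ | σ.Nonempty ∧ σ ∉ K}) := by
    ext f
    simp [prod_X_eq_monomial_reducedExponent, eq_comm, and_assoc]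
  rw [faceIdeal, h, mem_ideal_span_monomial_image]
  refine forall₂_congr fun m _ => ?_
  constructor
  · rintro ⟨_, ⟨σ, ⟨h1, h2⟩, rfl⟩, hle⟩ hm
    have hsub : σ ⊆ m.support := by
      simpa using Finsupp.support_mono hle
    rcases hm.mono hsub with h | h
    · exact h1.ne_empty h
    · exact h2 h
  · intro hm
    refine ⟨_, ⟨m.support, ⟨?_, fun h => hm (Or.inr h)⟩, rfl⟩, fun i => ?_⟩
    · rw [Finset.nonempty_iff_ne_empty]
      exact fun h => hm (Or.inl h)
    · rw [reducedExponent_apply]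
      split_ifs with hi
      · exact Nat.one_le_iff_ne_zero.mpr (Finsupp.mem_support_iff.mp hi)
      · exact Nat.zero_le _

theorem monomial_mem_faceIdeal {m : Fin n →₀ ℕ} (h : ¬ IsFace K m.support) (c : k) :
    monomial m c ∈ faceIdeal k K := by
  classical
  refine mem_faceIdeal.mpr fun m' hm' => ?_
  rw [support_monomial] at hm'
  split_ifs at hm' with hc
  · simp at hm'
  · rw [Finset.mem_singleton] at hm'
    rwa [hm']

theorem not_isFace_of_monomial_mem [Nontrivial k] {m : Fin n →₀ ℕ}
    (h : monomial m (1 : k) ∈ faceIdeal k K) : ¬ IsFace K m.support :=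
  mem_faceIdeal.mp h m (by simp)

/-- If `x^u` annihilates the class of `p`, then every monomial of `p` becomes a non-face when
multiplied by `x^u`. -/
theorem not_isFace_union_of_monomial_mul_mem {u : Fin n →₀ ℕ} {p : MvPolynomial (Fin n) k}
    (h : monomial u (1 : k) * p ∈ faceIdeal k K) {a : Fin n →₀ ℕ} (ha : a ∈ p.support) :
    ¬ IsFace K (a.support ∪ u.support) := by
  classical
  have := mem_faceIdeal.mp h (u + a) (by
    rw [MvPolynomial.mem_support_iff, coeff_monomial_mul, one_mul]
    exact MvPolynomial.mem_support_iff.mp ha)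
  rwa [Finsupp.support_add_eq_union, Finset.union_comm] at this

end Faces

/-! ### Operators on the face ring induced from the polynomial ring -/

section Induced

open MvPolynomial Finsupp

variable {k : Type*} [CommRing k] {n : ℕ} {K : PreAbstractSimplicialComplex (Fin n)}

theorem weylMonomial_monomial (a b m : Fin n →₀ ℕ) (c : k) :
    weylMonomial k a b (monomial m c) =
      monomial (a + (m - b)) (c * ∏ i, ((m i).choose (b i) : k)) := by
  simp [weylMonomial, dividedPowerOp_monomial, monomial_mul]

theorem weylMonomial_mem_faceIdeal {a b : Fin n →₀ ℕ} (h : IsAdmissible K a b)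
    {p : MvPolynomial (Fin n) k} (hp : p ∈ faceIdeal k K) :
    weylMonomial k a b p ∈ faceIdeal k K := by
  classical
  rw [p.as_sum, map_sum]
  refine Ideal.sum_mem _ fun m hm => ?_
  by_cases hbm : b ≤ m
  · rw [weylMonomial_monomial]
    refine monomial_mem_faceIdeal (fun hF => mem_faceIdeal.mp hp m hm ?_) _
    rw [Finsupp.support_add_eq_union] at hF
    refine (h _ hF).mono ?_
    rw [← Finsupp.support_add_eq_union, add_tsub_cancel_of_le hbm]
  · simp [weylMonomial, dividedPowerOp_monomial_eq_zero hbm]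

theorem isDiffOpOfOrder_weylMonomial (a b : Fin n →₀ ℕ) :
    IsDiffOpOfOrder k (MvPolynomial (Fin n) k) b.degree (weylMonomial k a b) :=
  (isDiffOpOfOrder_dividedPowerOp b).mulLeft_mul _

theorem exists_isInducedBy_weylMonomial {a b : Fin n →₀ ℕ} (h : IsAdmissible K a b) :
    ∃ θ : diffOps k (FaceRing k K), IsInducedBy θ (weylMonomial k a b) ∧
      IsDiffOpOfOrder k (FaceRing k K) b.degree θ := by
  let φ : Module.End k (FaceRing k K) :=
    Submodule.mapQ ((faceIdeal k K).restrictScalars k) ((faceIdeal k K).restrictScalars k)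
      (weylMonomial k a b) fun p hp => weylMonomial_mem_faceIdeal h hp
  have hφ : ∀ p, φ (Ideal.Quotient.mk (faceIdeal k K) p) =
      Ideal.Quotient.mk (faceIdeal k K) (weylMonomial k a b p) := fun p => rfl
  have ho : IsDiffOpOfOrder k (FaceRing k K) b.degree φ :=
    IsDiffOpOfOrder.of_semiconj (f := Ideal.Quotient.mkₐ k (faceIdeal k K))
      Ideal.Quotient.mk_surjective (isDiffOpOfOrder_weylMonomial a b) hφ
  exact ⟨⟨φ, _, ho⟩, hφ, ho⟩

/-- Whether `x^a ∂^(b)` preserves the face ideal can be read off from its values on the monomials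
`x^b x_T` with `T` disjoint from `supp b`, where its coefficient is `1`. -/
theorem IsInducedBy.isAdmissible [Nontrivial k] {a b : Fin n →₀ ℕ} {θ : diffOps k (FaceRing k K)}
    (h : IsInducedBy θ (weylMonomial k a b)) : IsAdmissible K a b := by
  classical
  intro G hG
  by_contra hbG
  let u := reducedExponent (G \ b.support)
  have hu : u.support = G \ b.support := support_reducedExponent _
  have hzero : Ideal.Quotient.mk (faceIdeal k K) (monomial (b + u) 1) = 0 := by
    refine Ideal.Quotient.eq_zero_iff_mem.mpr (monomial_mem_faceIdeal ?_ _)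
    rwa [Finsupp.support_add_eq_union, hu, Finset.union_sdiff_self_eq_union]
  have h1 := h (monomial (b + u) 1)
  rw [hzero, map_zero, eq_comm, Ideal.Quotient.eq_zero_iff_mem, weylMonomial_monomial,
    add_tsub_cancel_left, one_mul, Finset.prod_eq_one] at h1
  · refine not_isFace_of_monomial_mem h1 (hG.mono ?_)
    rw [Finsupp.support_add_eq_union, hu]
    exact Finset.union_subset_union_right Finset.sdiff_subset
  · intro i _
    by_cases hi : i ∈ b.support
    · have : u i = 0 := by
        rw [← Finsupp.notMem_support_iff, hu]; exact fun hc => (Finset.mem_sdiff.mp hc).2 hi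
      simp [this]
    · simp [Finsupp.notMem_support_iff.mp hi]

theorem IsInducedBy.eq {θ θ' : diffOps k (FaceRing k K)}
    {P : Module.End k (MvPolynomial (Fin n) k)} (h : IsInducedBy θ P) (h' : IsInducedBy θ' P) :
    θ = θ' := by
  refine Subtype.ext (LinearMap.ext fun r => ?_)
  obtain ⟨p, rfl⟩ := Ideal.Quotient.mk_surjective r
  rw [h, h']

theorem IsInducedBy.add {θ θ' : diffOps k (FaceRing k K)}
    {P P' : Module.End k (MvPolynomial (Fin n) k)} (h : IsInducedBy θ P)
    (h' : IsInducedBy θ' P') : IsInducedBy (θ + θ') (P + P') := fun f => by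
  simp [h f, h' f]

theorem IsInducedBy.sub {θ θ' : diffOps k (FaceRing k K)}
    {P P' : Module.End k (MvPolynomial (Fin n) k)} (h : IsInducedBy θ P)
    (h' : IsInducedBy θ' P') : IsInducedBy (θ - θ') (P - P') := fun f => by
  simp [h f, h' f]

theorem IsInducedBy.mul {θ θ' : diffOps k (FaceRing k K)}
    {P P' : Module.End k (MvPolynomial (Fin n) k)} (h : IsInducedBy θ P)
    (h' : IsInducedBy θ' P') : IsInducedBy (θ * θ') (P * P') := fun f => by
  simp [h' f, h (P' f)]

theorem IsInducedBy.smul (c : k) {θ : diffOps k (FaceRing k K)}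
    {P : Module.End k (MvPolynomial (Fin n) k)} (h : IsInducedBy θ P) :
    IsInducedBy (c • θ) (c • P) := fun f => by
  simp only [Subalgebra.coe_smul, LinearMap.smul_apply, h f]
  exact (map_smul (Ideal.Quotient.mkₐ k (faceIdeal k K)) c (P f)).symm

theorem isInducedBy_zero :
    IsInducedBy (0 : diffOps k (FaceRing k K)) 0 := fun f => by simp

theorem isInducedBy_mulOp (p : MvPolynomial (Fin n) k) :
    IsInducedBy (mulOp k (Ideal.Quotient.mk (faceIdeal k K) p)) (LinearMap.mulLeft k p) :=
  fun f => by simp [mulOp]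

end Induced

/-! ### The admissible operators span -/

section Spanning

open MvPolynomial Finsupp

variable {k : Type*} [CommRing k] {n : ℕ} {K : PreAbstractSimplicialComplex (Fin n)}

variable (k K) in
/-- The span of the admissible `x^a ∂^(b)` of order at most `M`, as operators on the polynomial
ring. -/
noncomputable def admissibleSpan (M : ℕ) : Submodule k (Module.End k (MvPolynomial (Fin n) k)) :=
  Submodule.span k ((fun p : (Fin n →₀ ℕ) × (Fin n →₀ ℕ) => weylMonomial k p.1 p.2) ''
    {p | IsAdmissible K p.1 p.2 ∧ p.2.degree ≤ M})

theorem exists_isInducedBy_of_mem_admissibleSpan {M : ℕ}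
    {P : Module.End k (MvPolynomial (Fin n) k)} (hP : P ∈ admissibleSpan k K M) :
    ∃ θ : diffOps k (FaceRing k K), IsInducedBy θ P ∧
      IsDiffOpOfOrder k (FaceRing k K) M θ := by
  induction hP using Submodule.span_induction with
  | mem P hP =>
    obtain ⟨p, ⟨h, hM⟩, rfl⟩ := hP
    obtain ⟨θ, h1, h2⟩ := exists_isInducedBy_weylMonomial (k := k) h
    exact ⟨θ, h1, h2.mono hM⟩
  | zero => exact ⟨0, isInducedBy_zero, IsDiffOpOfOrder.zero_mem M⟩
  | add P Q _ _ hP hQ =>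
    obtain ⟨θ, h1, h2⟩ := hP
    obtain ⟨θ', h1', h2'⟩ := hQ
    exact ⟨θ + θ', h1.add h1', h2.add h2'⟩
  | smul c P _ hP =>
    obtain ⟨θ, h1, h2⟩ := hP
    exact ⟨c • θ, h1.smul c, h2.smul c⟩

/-- Every monomial of a lift of `φ(x^b)` is admissible for `b`: if `supp b ∪ G` is not a face then
`x_G` kills `x^b`, so a power of `x_G` kills `φ(x^b)`. -/
theorem IsDiffOpOfOrder.isAdmissible {M : ℕ} {φ : Module.End k (FaceRing k K)}
    (hφ : IsDiffOpOfOrder k (FaceRing k K) M φ) {b : Fin n →₀ ℕ} {p : MvPolynomial (Fin n) k}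
    (hp : φ (Ideal.Quotient.mk _ (monomial b 1)) = Ideal.Quotient.mk _ p) {a : Fin n →₀ ℕ}
    (ha : a ∈ p.support) : IsAdmissible K a b := by
  classical
  intro G hG
  by_contra hbG
  let u := reducedExponent G
  have hu : u.support = G := support_reducedExponent G
  have h0 : Ideal.Quotient.mk (faceIdeal k K) (monomial u 1) *
      Ideal.Quotient.mk (faceIdeal k K) (monomial b 1) = 0 := by
    rw [← map_mul, monomial_mul, one_mul]
    refine Ideal.Quotient.eq_zero_iff_mem.mpr (monomial_mem_faceIdeal ?_ _)
    rwa [Finsupp.support_add_eq_union, hu, Finset.union_comm]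
  have h1 := hφ.pow_succ_mul_apply_eq_zero h0
  rw [hp, ← map_pow, ← map_mul, Ideal.Quotient.eq_zero_iff_mem, monomial_pow, one_pow] at h1
  have h2 := not_isFace_union_of_monomial_mul_mem h1 ha
  rw [Finsupp.support_smul_eq (Nat.succ_ne_zero M), hu] at h2
  exact h2 hG

/-- A differential operator of order at most `M` is determined by its values on the monomials of
degree at most `M`. -/
theorem IsDiffOpOfOrder.eq_zero_of_forall_degree_le {I : Ideal (MvPolynomial (Fin n) k)} {M : ℕ}
    {φ : Module.End k (MvPolynomial (Fin n) k ⧸ I)}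
    (hφ : IsDiffOpOfOrder k (MvPolynomial (Fin n) k ⧸ I) M φ)
    (h : ∀ m : Fin n →₀ ℕ, m.degree ≤ M → φ (Ideal.Quotient.mk I (monomial m 1)) = 0) :
    φ = 0 := by
  induction M generalizing φ with
  | zero =>
    obtain ⟨r, rfl⟩ := hφ
    have h0 := h 0 (by simp)
    rw [monomial_zero', C_1, map_one, LinearMap.mulLeft_apply, mul_one] at h0
    rw [h0, LinearMap.mulLeft_zero_eq_zero]
  | succ M ih =>
    have comm : ∀ (i : Fin n) (r : MvPolynomial (Fin n) k ⧸ I),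
        φ (Ideal.Quotient.mk I (X i) * r) = Ideal.Quotient.mk I (X i) * φ r := by
      intro i r
      have h0 := ih (hφ (Ideal.Quotient.mk I (X i))) fun m hm => by
        have h1 := h m (by omega)
        have h2 := h (single i 1 + m) (by rw [map_add, degree_single]; omega)
        have h3 : Ideal.Quotient.mk I (X i) * Ideal.Quotient.mk I (monomial m 1) =
            Ideal.Quotient.mk I (monomial (single i 1 + m) 1) := by
          rw [← map_mul, X, monomial_mul, one_mul]
        simp [h1, h2, h3]
      exact sub_eq_zero.mp (by simpa using LinearMap.congr_fun h0 r)
    refine LinearMap.ext fun r => ?_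
    obtain ⟨p, rfl⟩ := Ideal.Quotient.mk_surjective r
    induction p using MvPolynomial.induction_on with
    | C c =>
      have h0 := h 0 (by simp)
      have h1 : Ideal.Quotient.mk I (C c) = c • Ideal.Quotient.mk I (monomial 0 1) := by
        have := map_smul (Ideal.Quotient.mkₐ k I) c (monomial 0 1)
        rw [smul_monomial, smul_eq_mul, mul_one] at this
        exact this
      rw [h1, map_smul, h0, smul_zero, LinearMap.zero_apply]
    | add p q hp hq => rw [map_add, map_add, hp, hq, map_add]
    | mul_X p i hp =>
      rw [map_mul, mul_comm, comm, hp, LinearMap.zero_apply, mul_zero, LinearMap.zero_apply]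

theorem mulLeft_mul_dividedPowerOp_eq_sum (p : MvPolynomial (Fin n) k) (b : Fin n →₀ ℕ) :
    LinearMap.mulLeft k p * dividedPowerOp k b =
      ∑ a ∈ p.support, coeff a p • weylMonomial k a b := by
  refine LinearMap.ext fun f => ?_
  conv_lhs => rw [p.as_sum]
  simp only [Module.End.mul_apply, LinearMap.mulLeft_apply, Finset.sum_mul, LinearMap.sum_apply,
    LinearMap.smul_apply, weylMonomial, ← smul_mul_assoc, smul_monomial, smul_eq_mul, mul_one]

theorem eq_of_le_of_degree_le {b m : Fin n →₀ ℕ} (hle : b ≤ m) (h : m.degree ≤ b.degree) :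
    m = b := by
  obtain ⟨d, rfl⟩ := le_iff_exists_add.mp hle
  rw [map_add] at h
  rw [(degree_eq_zero_iff d).mp (by omega), add_zero]

theorem dividedPowerOp_monomial_of_degree_le {b m : Fin n →₀ ℕ} (h : m.degree ≤ b.degree) :
    dividedPowerOp k b (monomial m 1) = if m = b then 1 else 0 := by
  split_ifs with hm
  · subst hm
    simp [dividedPowerOp_monomial]
  · exact dividedPowerOp_monomial_eq_zero (fun hle => hm (eq_of_le_of_degree_le hle h)) _

/-- Subtracting the operators `φ(x^b) ∂^(b)` with `|b| = l` kills the values of `φ` in degree `l`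
without changing those in lower degree. -/
theorem exists_mem_admissibleSpan_agree {M : ℕ} {φ : diffOps k (FaceRing k K)}
    (hφ : IsDiffOpOfOrder k (FaceRing k K) M φ) (l : ℕ) (hl : l ≤ M + 1) :
    ∃ P ∈ admissibleSpan k K M, ∃ θ : diffOps k (FaceRing k K), IsInducedBy θ P ∧
      IsDiffOpOfOrder k (FaceRing k K) M θ ∧
      ∀ m : Fin n →₀ ℕ, m.degree < l →
        (φ - θ : diffOps k (FaceRing k K)).1 (Ideal.Quotient.mk _ (monomial m 1)) = 0 := by
  classical
  induction l with
  | zero =>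
    exact ⟨0, zero_mem _, 0, isInducedBy_zero, IsDiffOpOfOrder.zero_mem M, fun m hm => by omega⟩
  | succ l ih =>
    obtain ⟨P, hP, θ, hθP, hθ, hlow⟩ := ih (by omega)
    have hsub : IsDiffOpOfOrder k (FaceRing k K) M (φ - θ : diffOps k (FaceRing k K)).1 :=
      IsDiffOpOfOrder.sub hφ hθ
    choose p hp using fun b : Fin n →₀ ℕ => Ideal.Quotient.mk_surjective
      ((φ - θ : diffOps k (FaceRing k K)).1 (Ideal.Quotient.mk _ (monomial b 1)))
    let F : Finset (Fin n →₀ ℕ) := (finite_of_degree_eq (σ := Fin n) l).toFinset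
    have hF : ∀ b, b ∈ F ↔ b.degree = l := fun b => by simp [F]
    let Q := ∑ b ∈ F, LinearMap.mulLeft k (p b) * dividedPowerOp k b
    have hQ : Q ∈ admissibleSpan k K M := by
      refine Submodule.sum_mem _ fun b hb => ?_
      rw [mulLeft_mul_dividedPowerOp_eq_sum]
      refine Submodule.sum_mem _ fun a ha => Submodule.smul_mem _ _ (Submodule.subset_span ?_)
      exact ⟨(a, b), ⟨hsub.isAdmissible (hp b).symm ha, by rw [(hF b).mp hb]; omega⟩, rfl⟩
    obtain ⟨η, hηQ, hη⟩ := exists_isInducedBy_of_mem_admissibleSpan hQ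
    refine ⟨P + Q, add_mem hP hQ, θ + η, hθP.add hηQ, hθ.add hη, fun m hm => ?_⟩
    have hval : η.1 (Ideal.Quotient.mk _ (monomial m 1)) =
        Ideal.Quotient.mk _ (if m.degree = l then p m else 0) := by
      rw [hηQ]
      congr 1
      simp only [Q, LinearMap.sum_apply, Module.End.mul_apply, LinearMap.mulLeft_apply]
      rw [Finset.sum_congr rfl fun b hb => by
        rw [dividedPowerOp_monomial_of_degree_le (by rw [(hF b).mp hb]; omega)]]
      simp [hF]
    have hsplit : (φ - (θ + η) : diffOps k (FaceRing k K)).1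
          (Ideal.Quotient.mk _ (monomial m 1)) =
        (φ - θ : diffOps k (FaceRing k K)).1 (Ideal.Quotient.mk _ (monomial m 1)) -
          η.1 (Ideal.Quotient.mk _ (monomial m 1)) := by
      simp [sub_sub]
    rw [hsplit, hval]
    split_ifs with h
    · rw [← hp m, sub_self]
    · rw [hlow m (by omega), map_zero, sub_zero]

/-- The admissible `x^a ∂^(b)` span the ring of differential operators on the face ring. -/
theorem exists_isInducedBy_sum (φ : diffOps k (FaceRing k K)) :
    ∃ (F : Finset ((Fin n →₀ ℕ) × (Fin n →₀ ℕ))) (c : (Fin n →₀ ℕ) × (Fin n →₀ ℕ) → k),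
      (∀ p ∈ F, IsAdmissible K p.1 p.2) ∧
      IsInducedBy φ (∑ p ∈ F, c p • weylMonomial k p.1 p.2) := by
  obtain ⟨M, hM⟩ := φ.2
  obtain ⟨P, hP, θ, hθP, hθ, hlow⟩ := exists_mem_admissibleSpan_agree hM (M + 1) le_rfl
  have h0 := IsDiffOpOfOrder.eq_zero_of_forall_degree_le (IsDiffOpOfOrder.sub hM hθ)
    fun m hm => hlow m (by omega)
  obtain rfl : φ = θ := Subtype.ext (sub_eq_zero.mp h0)
  obtain ⟨c, hc, rfl⟩ := (Finsupp.mem_span_image_iff_linearCombination k).mp hP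
  exact ⟨c.support, c, fun p hp => (hc hp).1, hθP⟩

end Spanning

/-! ### Two-sided ideals -/

section Ideals

open MvPolynomial Finsupp

variable {k : Type*} [CommRing k] {n : ℕ} {K : PreAbstractSimplicialComplex (Fin n)}

/-- The operator `P` on the polynomial ring descends to a differential operator on the face ring
that belongs to `I`. -/
def InducesMem (I : TwoSidedIdeal (diffOps k (FaceRing k K)))
    (P : Module.End k (MvPolynomial (Fin n) k)) : Prop :=
  ∃ θ ∈ I, IsInducedBy θ P

variable {I J : TwoSidedIdeal (diffOps k (FaceRing k K))}
  {P Q : Module.End k (MvPolynomial (Fin n) k)}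

theorem IsInducedBy.mem_iff {θ : diffOps k (FaceRing k K)} (h : IsInducedBy θ P) :
    θ ∈ I ↔ InducesMem I P :=
  ⟨fun hθ => ⟨θ, hθ, h⟩, fun ⟨_, hη, hP⟩ => h.eq hP ▸ hη⟩

theorem InducesMem.add (hP : InducesMem I P) (hQ : InducesMem I Q) : InducesMem I (P + Q) :=
  let ⟨_, h1, h2⟩ := hP
  let ⟨_, h1', h2'⟩ := hQ
  ⟨_, I.add_mem h1 h1', h2.add h2'⟩

theorem InducesMem.sub (hP : InducesMem I P) (hQ : InducesMem I Q) : InducesMem I (P - Q) :=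
  let ⟨_, h1, h2⟩ := hP
  let ⟨_, h1', h2'⟩ := hQ
  ⟨_, I.sub_mem h1 h1', h2.sub h2'⟩

theorem inducesMem_zero : InducesMem I 0 := ⟨0, I.zero_mem, isInducedBy_zero⟩

theorem InducesMem.mul_left (hP : InducesMem I P) {η : diffOps k (FaceRing k K)}
    (hQ : IsInducedBy η Q) : InducesMem I (Q * P) :=
  let ⟨_, h1, h2⟩ := hP
  ⟨_, I.mul_mem_left _ _ h1, hQ.mul h2⟩

theorem InducesMem.mul_right (hP : InducesMem I P) {η : diffOps k (FaceRing k K)}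
    (hQ : IsInducedBy η Q) : InducesMem I (P * Q) :=
  let ⟨_, h1, h2⟩ := hP
  ⟨_, I.mul_mem_right _ _ h1, h2.mul hQ⟩

theorem InducesMem.smul (c : k) (hP : InducesMem I P) : InducesMem I (c • P) := by
  have : c • P = LinearMap.mulLeft k (C c) * P := by
    exact LinearMap.ext fun p => by simp [smul_eq_C_mul]
  rw [this]
  exact hP.mul_left (isInducedBy_mulOp _)

theorem InducesMem.sum {ι : Type*} {s : Finset ι} {f : ι → Module.End k (MvPolynomial (Fin n) k)}
    (h : ∀ i ∈ s, InducesMem I (f i)) : InducesMem I (∑ i ∈ s, f i) :=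
  Finset.sum_induction _ _ (fun _ _ => InducesMem.add) inducesMem_zero h

/-- The commutator with `x_i` lowers the exponent of `∂_i` by one. -/
theorem commutator_X_weylMonomial (a b d : Fin n →₀ ℕ) (i : Fin n) :
    (if d ≤ b then weylMonomial k a (b - d) else 0) * LinearMap.mulLeft k (X i) -
      LinearMap.mulLeft k (X i) * (if d ≤ b then weylMonomial k a (b - d) else 0) =
    if d + single i 1 ≤ b then weylMonomial k a (b - (d + single i 1)) else 0 := by
  have hcomm : LinearMap.mulLeft k (X i) * LinearMap.mulLeft k (monomial a (1 : k)) =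
      LinearMap.mulLeft k (monomial a (1 : k)) * LinearMap.mulLeft k (X i) := by
    refine LinearMap.ext fun p => ?_
    simp [mul_left_comm]
  by_cases hd : d ≤ b
  · obtain ⟨c, rfl⟩ := le_iff_exists_add.mp hd
    rw [if_pos hd, add_tsub_cancel_left]
    simp only [add_le_add_iff_left, weylMonomial]
    rw [← mul_assoc, hcomm, mul_assoc, mul_assoc, ← mul_sub]
    split_ifs with hc
    · obtain ⟨e, rfl⟩ := le_iff_exists_add'.mp hc
      have h1 : d + (e + single i 1) - (d + single i 1) = e := by
        rw [add_tsub_add_eq_tsub_left, add_tsub_cancel_right]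
      rw [h1, dividedPowerOp_add_single_mul_X, add_sub_cancel_left]
    · have : c i = 0 := by
        by_contra h
        exact hc (Finsupp.single_le_iff.mpr (Nat.one_le_iff_ne_zero.mpr h))
      rw [dividedPowerOp_mul_X_of_eq_zero this, sub_self, mul_zero]
  · have : ¬ d + single i 1 ≤ b := fun h => hd (le_self_add.trans h)
    simp [hd, this]

/-- Iterated commutators with the variables lower the exponents of all `∂^(b)` by `d`. -/
theorem InducesMem.lower {F : Finset ((Fin n →₀ ℕ) × (Fin n →₀ ℕ))}
    {c : (Fin n →₀ ℕ) × (Fin n →₀ ℕ) → k}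
    (h : InducesMem I (∑ p ∈ F, c p • weylMonomial k p.1 p.2)) (d : Fin n →₀ ℕ) :
    InducesMem I (∑ p ∈ F, c p • if d ≤ p.2 then weylMonomial k p.1 (p.2 - d) else 0) := by
  let T (d : Fin n →₀ ℕ) : Module.End k (MvPolynomial (Fin n) k) :=
    ∑ p ∈ F, c p • if d ≤ p.2 then weylMonomial k p.1 (p.2 - d) else 0
  have step : ∀ d i, InducesMem I (T d) → InducesMem I (T (d + single i 1)) := by
    intro d i hd
    have : T (d + single i 1) = T d * LinearMap.mulLeft k (X i) -
        LinearMap.mulLeft k (X i) * T d := by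
      simp only [T, Finset.sum_mul, Finset.mul_sum, ← Finset.sum_sub_distrib]
      refine Finset.sum_congr rfl fun p _ => ?_
      rw [← commutator_X_weylMonomial, smul_sub, smul_mul_assoc, mul_smul_comm]
    rw [this]
    exact (hd.mul_right (isInducedBy_mulOp _)).sub (hd.mul_left (isInducedBy_mulOp _))
  have key : ∀ d d', InducesMem I (T d') → InducesMem I (T (d' + d)) := by
    intro d
    induction d using Finsupp.induction_linear with
    | zero => simp
    | add d₁ d₂ h₁ h₂ =>
      intro d' hd'
      rw [← add_assoc]
      exact h₂ _ (h₁ _ hd')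
    | single i t =>
      induction t with
      | zero => simp
      | succ t ih =>
        intro d' hd'
        rw [single_add, ← add_assoc]
        exact step _ _ (ih _ hd')
  have h0 : InducesMem I (T 0) := by simpa [T] using h
  simpa [T] using key d 0 h0

theorem isInducedBy_of_support_subset {a b : Fin n →₀ ℕ} (h : b.support ⊆ a.support) :
    ∃ θ : diffOps k (FaceRing k K), IsInducedBy θ (weylMonomial k a b) :=
  let ⟨θ, hθ, _⟩ := exists_isInducedBy_weylMonomial (IsAdmissible.of_support_subset h)
  ⟨θ, hθ⟩

/-- If multiplication by `p` is in the ideal, so is multiplication by `x_i^e ∂_i^(e) p`, by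
induction on `e` from the Leibniz rule
`x_i^e ∂_i^(e) ∘ p = ∑ (x_i^j ∂_i^(j) p) ∘ x_i^(e-j) ∂_i^(e-j)`. -/
theorem InducesMem.mulLeft_weylMonomial_single {p : MvPolynomial (Fin n) k}
    (h : InducesMem I (LinearMap.mulLeft k p)) (i : Fin n) (e : ℕ) :
    InducesMem I (LinearMap.mulLeft k (weylMonomial k (single i e) (single i e) p)) := by
  have hmem (e : ℕ) : ∃ θ : diffOps k (FaceRing k K),
      IsInducedBy θ (weylMonomial k (single i e) (single i e)) :=
    isInducedBy_of_support_subset subset_rfl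
  induction e using Nat.strong_induction_on with
  | _ e ih =>
  have key : weylMonomial k (single i e) (single i e) * LinearMap.mulLeft k p =
      ∑ jl ∈ Finset.HasAntidiagonal.antidiagonal e,
        LinearMap.mulLeft k (weylMonomial k (single i jl.1) (single i jl.1) p) *
          weylMonomial k (single i jl.2) (single i jl.2) := by
    rw [weylMonomial, mul_assoc, dividedPowerOp_single_mul_mulLeft, Finset.mul_sum]
    refine Finset.sum_congr rfl fun jl hjl => LinearMap.ext fun q => ?_
    have : monomial (single i e) (1 : k) =
        monomial (single i jl.1) 1 * monomial (single i jl.2) 1 := by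
      rw [monomial_mul, ← single_add, Finset.HasAntidiagonal.mem_antidiagonal.mp hjl, one_mul]
    simp only [weylMonomial, Module.End.mul_apply, LinearMap.mulLeft_apply, this]
    ring
  have hmem0 : ((e, 0) : ℕ × ℕ) ∈ Finset.HasAntidiagonal.antidiagonal e := by simp
  rw [← Finset.add_sum_erase _ _ hmem0] at key
  have hone : weylMonomial k (single i 0) (single i 0) = 1 := by
    simp [weylMonomial, dividedPowerOp_zero]; rfl
  rw [hone, mul_one] at key
  rw [eq_sub_of_add_eq key.symm]
  obtain ⟨θ, hθ⟩ := hmem e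
  refine (h.mul_left hθ).sub (.sum fun jl hjl => ?_)
  obtain ⟨η, hη⟩ := hmem jl.2
  rw [Finset.mem_erase, Finset.HasAntidiagonal.mem_antidiagonal] at hjl
  refine (ih jl.1 ?_).mul_right hη
  by_contra hlt
  exact hjl.1 (Prod.ext (by simp; omega) (by simp; omega))

theorem weylMonomial_single_monomial (i : Fin n) (e : ℕ) (m : Fin n →₀ ℕ) (c : k) :
    weylMonomial k (single i e) (single i e) (monomial m c) =
      monomial m (c * ((m i).choose e : k)) := by
  rw [weylMonomial, Module.End.mul_apply, dividedPowerOp_single_monomial,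
    LinearMap.mulLeft_apply, monomial_mul, one_mul]
  rcases le_or_gt e (m i) with h | h
  · rw [add_tsub_cancel_of_le (Finsupp.single_le_iff.mpr h)]
  · simp [Nat.choose_eq_zero_of_lt h]

/-- An ideal that contains multiplication by a polynomial contains multiplication by each of its
terms: the operators `x_i^e ∂_i^(e)` with `e` the exponents of a term of maximal degree single out
that term. -/
theorem InducesMem.mulLeft_monomial {s : Finset (Fin n →₀ ℕ)} {c : (Fin n →₀ ℕ) → k}
    (h : InducesMem I (LinearMap.mulLeft k (∑ a ∈ s, monomial a (c a)))) :
    ∀ a ∈ s, InducesMem I (LinearMap.mulLeft k (monomial a (c a))) := by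
  classical
  induction s using Finset.induction_on_max_value (fun a : Fin n →₀ ℕ => a.degree) with
  | empty => simp
  | insert a s ha hmax ih =>
    -- Each `x_i^e ∂_i^(e)` with `e = a i` multiplies the coefficient of `x^m` by `m i choose a i`.
    have weight : ∀ T : Finset (Fin n), InducesMem I (LinearMap.mulLeft k
        (∑ x ∈ insert a s, monomial x (c x * ∏ i ∈ T, ((x i).choose (a i) : k)))) := by
      intro T
      induction T using Finset.induction_on with
      | empty => simpa using h
      | insert i T hi hT =>
        have := hT.mulLeft_weylMonomial_single i (a i)
        rw [map_sum] at this
        convert this using 3 with x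
        rw [weylMonomial_single_monomial, Finset.prod_insert hi]
        congr 1
        ring
    have htop : InducesMem I (LinearMap.mulLeft k (monomial a (c a))) := by
      convert weight Finset.univ using 2
      rw [Finset.sum_insert ha, Finset.sum_eq_zero, add_zero]
      · simp
      · intro x hx
        have hne : x ≠ a := fun h => ha (h ▸ hx)
        obtain ⟨i, hi⟩ : ∃ i, x i < a i := by
          by_contra! hle
          exact hne (eq_of_le_of_degree_le hle (hmax x hx))
        rw [Finset.prod_eq_zero (Finset.mem_univ i)
          (by rw [Nat.choose_eq_zero_of_lt hi, Nat.cast_zero]), mul_zero, monomial_zero]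
    have hrest : InducesMem I (LinearMap.mulLeft k (∑ x ∈ s, monomial x (c x))) := by
      convert h.sub htop using 1
      rw [Finset.sum_insert ha]
      refine LinearMap.ext fun q => ?_
      simp [add_mul]
    intro x hx
    rcases Finset.mem_insert.mp hx with rfl | hx
    · exact htop
    · exact ih hrest x hx

/-- One step in lowering the exponent of a monomial. In
`x_i^q ∂_i^(q+1) x_i^(q+1) = ∑ (q+1 choose j) x_i^(2q+1-j) ∂_i^(q+1-j)` the term `j = q + 1` is
`x_i^q`, and all the others are left multiples of some `x_i^(q+1) ∂_i^(l)`. -/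
theorem InducesMem.lower_exponent {a v : Fin n →₀ ℕ} {i : Fin n} (hi : i ∈ v.support) {q : ℕ}
    (hq : q ≠ 0) (hai : a i = q + 1) {c : k}
    (h : ∀ t, IsAdmissible K v t → InducesMem I (c • weylMonomial k a t)) {t : Fin n →₀ ℕ}
    (ht : IsAdmissible K v t) : InducesMem I (c • weylMonomial k (a - single i 1) t) := by
  obtain ⟨θ, hθ⟩ : ∃ θ : diffOps k (FaceRing k K),
      IsInducedBy θ (weylMonomial k (single i q) (single i (q + 1))) := by
    refine isInducedBy_of_support_subset ?_
    rw [Finsupp.support_single i hq, Finsupp.support_single i (Nat.succ_ne_zero q)]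
  have h1 := (h t ht).mul_left hθ
  have key : weylMonomial k (single i q) (single i (q + 1)) * (c • weylMonomial k a t) =
      ∑ jl ∈ Finset.HasAntidiagonal.antidiagonal (q + 1), c • (LinearMap.mulLeft k
        (monomial (single i q + (a - single i jl.1)) (((q + 1).choose jl.1 : ℕ) : k)) *
          (dividedPowerOp k (single i jl.2) * dividedPowerOp k t)) := by
    have e : weylMonomial k (single i q) (single i (q + 1)) * weylMonomial k a t =
        LinearMap.mulLeft k (monomial (single i q) 1) *
          (dividedPowerOp k (single i (q + 1)) * LinearMap.mulLeft k (monomial a 1)) *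
            dividedPowerOp k t := by
      simp only [weylMonomial, mul_assoc]
    rw [mul_smul_comm, e, dividedPowerOp_single_mul_mulLeft, Finset.mul_sum, Finset.sum_mul,
      Finset.smul_sum]
    refine Finset.sum_congr rfl fun jl _ => ?_
    congr 1
    rw [dividedPowerOp_single_monomial, hai, one_mul, ← mul_assoc, ← mul_assoc,
      mulLeft_mul_mulLeft, monomial_mul, one_mul]
  have hmem0 : ((q + 1, 0) : ℕ × ℕ) ∈ Finset.HasAntidiagonal.antidiagonal (q + 1) := by simp
  rw [← Finset.add_sum_erase _ _ hmem0] at key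
  have hlead : c • (LinearMap.mulLeft k (monomial (single i q + (a - single i (q + 1)))
        (((q + 1).choose (q + 1) : ℕ) : k)) *
          (dividedPowerOp k (single i 0) * dividedPowerOp k t)) =
      c • weylMonomial k (a - single i 1) t := by
    have : single i q + (a - single i (q + 1)) = a - single i 1 := by
      ext x
      rcases eq_or_ne x i with rfl | hx
      · simp [hai, -single_add]
      · simp [single_eq_of_ne hx, -single_add]
    rw [this, single_zero, dividedPowerOp_zero, one_mul, Nat.choose_self, Nat.cast_one,
      weylMonomial]
  rw [hlead] at key
  rw [eq_sub_of_add_eq key.symm]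
  refine h1.sub (.sum fun jl hjl => ?_)
  obtain ⟨j, l⟩ := jl
  rw [Finset.mem_erase, Finset.HasAntidiagonal.mem_antidiagonal] at hjl
  obtain ⟨hne, hsum⟩ := hjl
  have hjq : j ≤ q := by
    by_contra hlt
    exact hne (Prod.ext (by simp at hsum ⊢; omega) (by simp at hsum ⊢; omega))
  have hexp : single i q + (a - single i j) = single i (q - j) + a := by
    ext x
    rcases eq_or_ne x i with rfl | hx
    · simp [hai]; omega
    · simp [single_eq_of_ne hx]
  have hadm : IsAdmissible K v (single i l + t) := by
    rw [add_comm]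
    refine ht.add (Finsupp.support_single_subset.trans ?_)
    simpa using hi
  have h2 := ((h _ hadm).mul_left
    (isInducedBy_mulOp (monomial (single i (q - j)) (((q + 1).choose j : ℕ) : k)))).smul
      (∏ x, (((single i l : Fin n →₀ ℕ) x + t x).choose ((single i l : Fin n →₀ ℕ) x) : k))
  convert h2 using 1
  simp only [hexp, weylMonomial, dividedPowerOp_mul, mul_smul_comm]
  rw [smul_comm, ← mul_assoc, mulLeft_mul_mulLeft, monomial_mul, mul_one]

/-- Repeated lowering replaces `x^a` by the reduced monomial with the same support. The exponent of
`∂` has to range over all admissible `t`, since each step uses those of larger degree. -/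
theorem InducesMem.reduce_exponent {v : Fin n →₀ ℕ} {c : k} (a : Fin n →₀ ℕ)
    (hv : a.support = v.support)
    (h : ∀ t, IsAdmissible K v t → InducesMem I (c • weylMonomial k a t)) :
    ∀ t, IsAdmissible K v t →
      InducesMem I (c • weylMonomial k (reducedExponent v.support) t) := by
  induction hN : a.degree using Nat.strong_induction_on generalizing a with
  | _ N ih =>
  subst hN
  by_cases hall : ∀ i, a i ≤ 1
  · have : reducedExponent v.support = a := by
      ext i
      rw [reducedExponent_apply, ← hv]
      have := hall i
      split_ifs with hi
      · have := Finsupp.mem_support_iff.mp hi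
        omega
      · exact (Finsupp.notMem_support_iff.mp hi).symm
    rwa [this]
  · push Not at hall
    obtain ⟨i, hi⟩ := hall
    obtain ⟨q, hq⟩ : ∃ q, a i = q + 1 := ⟨a i - 1, by omega⟩
    have hle : single i 1 ≤ a := Finsupp.single_le_iff.mpr (by omega)
    refine ih (a - single i 1).degree ?_ (a - single i 1) ?_ (fun t ht =>
      InducesMem.lower_exponent (hv ▸ Finsupp.mem_support_iff.mpr (by omega))
        (by omega) hq h ht) rfl
    · have := congrArg degree (add_tsub_cancel_of_le hle)
      rw [map_add, degree_single] at this
      omega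
    · rw [← hv]
      ext x
      rcases eq_or_ne x i with rfl | hx
      · simp; omega
      · simp [single_eq_of_ne hx]

/-- If `c x^a` is in an ideal, then so is `c x_A ∂^(t)`, where `A = supp a`, for every admissible
`t`: multiply by `x_A ∂^(t)` on the right, which frees the exponent of `∂`, and then reduce the
exponent of `x`. -/
theorem InducesMem.reducedExponent_weylMonomial {a : Fin n →₀ ℕ} {c : k}
    (h : InducesMem I (LinearMap.mulLeft k (monomial a c))) {t : Fin n →₀ ℕ}
    (ht : IsAdmissible K a t) :
    InducesMem I (c • weylMonomial k (reducedExponent a.support) t) := by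
  classical
  refine InducesMem.reduce_exponent (a + reducedExponent a.support) ?_ (fun t ht => ?_) t ht
  · rw [Finsupp.support_add_eq_union, support_reducedExponent, Finset.union_self]
  · obtain ⟨θ, hθ, _⟩ := exists_isInducedBy_weylMonomial (k := k)
      (ht.mono (a' := reducedExponent a.support) (by simp) subset_rfl)
    convert h.mul_right hθ using 1
    rw [weylMonomial, weylMonomial, ← mul_assoc, mulLeft_mul_mulLeft, monomial_mul, mul_one,
      ← smul_mul_assoc, smul_mulLeft, smul_monomial, smul_eq_mul, mul_one]

theorem isInducedBy_smul_reducedMonomial (c : k) (τ : Finset (Fin n)) :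
    IsInducedBy (c • reducedMonomial k K τ) (c • weylMonomial k (reducedExponent τ) 0) := by
  rw [weylMonomial, dividedPowerOp_zero, mul_one, ← prod_X_eq_monomial_reducedExponent]
  exact (isInducedBy_mulOp _).smul c

theorem InducesMem.smul_reducedMonomial_mem {a : Fin n →₀ ℕ} {c : k}
    (h : InducesMem I (LinearMap.mulLeft k (monomial a c))) :
    c • reducedMonomial k K a.support ∈ I :=
  (isInducedBy_smul_reducedMonomial c _).mem_iff.mpr
    (h.reducedExponent_weylMonomial (IsAdmissible.of_support_subset (by simp)))

/-- An ideal that contains `c x_A` contains `c x^a ∂^(b)` for all admissible `(a, b)` with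
`supp a = A`. -/
theorem inducesMem_weylMonomial_of_smul_reducedMonomial_mem {a b : Fin n →₀ ℕ} {c : k}
    (h : c • reducedMonomial k K a.support ∈ I) (hab : IsAdmissible K a b) :
    InducesMem I (c • weylMonomial k a b) := by
  have h1 : InducesMem I (LinearMap.mulLeft k (monomial (reducedExponent a.support) c)) := by
    convert (isInducedBy_smul_reducedMonomial c _).mem_iff.mp h using 1
    rw [weylMonomial, dividedPowerOp_zero, mul_one, smul_mulLeft, smul_monomial, smul_eq_mul,
      mul_one]
  have h2 := h1.reducedExponent_weylMonomial (t := b) (hab.mono (by simp) subset_rfl)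
  rw [support_reducedExponent] at h2
  have hle : reducedExponent a.support ≤ a := fun i => by
    rw [reducedExponent_apply]
    split_ifs with hi
    · exact Nat.one_le_iff_ne_zero.mpr (Finsupp.mem_support_iff.mp hi)
    · exact Nat.zero_le _
  convert h2.mul_left (isInducedBy_mulOp (monomial (a - reducedExponent a.support) 1)) using 1
  rw [mul_smul_comm, weylMonomial, weylMonomial, ← mul_assoc, mulLeft_mul_mulLeft,
    monomial_mul, mul_one, tsub_add_cancel_of_le hle]

theorem InducesMem.mulLeft_of_weylMonomial {a b : Fin n →₀ ℕ}
    (h : InducesMem I (weylMonomial k a b)) :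
    InducesMem I (LinearMap.mulLeft k (monomial a 1)) := by
  have h1 : InducesMem I (∑ p ∈ {(a, b)}, (1 : k) • weylMonomial k p.1 p.2) := by simpa using h
  have h2 := InducesMem.lower (c := fun _ => 1) h1 b
  simpa [weylMonomial, dividedPowerOp_zero] using h2

/-- If an operator of a two-sided ideal is written in terms of the admissible `x^a ∂^(b)`, then
each of its terms lies in every ideal `J` that contains all the `c x_τ` of `I`. The terms are split
off in order of decreasing `|b|`. -/
theorem InducesMem.of_smul_reducedMonomial_mem
    (hIJ : ∀ (c : k) (τ : Finset (Fin n)),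
      c • reducedMonomial k K τ ∈ I → c • reducedMonomial k K τ ∈ J)
    {F : Finset ((Fin n →₀ ℕ) × (Fin n →₀ ℕ))} {c : (Fin n →₀ ℕ) × (Fin n →₀ ℕ) → k}
    (hF : ∀ p ∈ F, IsAdmissible K p.1 p.2)
    (h : InducesMem I (∑ p ∈ F, c p • weylMonomial k p.1 p.2)) :
    InducesMem J (∑ p ∈ F, c p • weylMonomial k p.1 p.2) := by
  classical
  induction F using Finset.induction_on_max_value
    (fun p : (Fin n →₀ ℕ) × (Fin n →₀ ℕ) => p.2.degree) with
  | empty => simpa using inducesMem_zero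
  | insert p F hp hmax ih =>
    obtain ⟨a, b⟩ := p
    have hab : IsAdmissible K a b := hF _ (Finset.mem_insert_self _ _)
    -- Lowering by `b` kills all terms except those with exponent exactly `b`.
    have htop : InducesMem I (LinearMap.mulLeft k (monomial a (c (a, b)))) := by
      let s := ((insert (a, b) F).filter fun p => p.2 = b)
      have hs : InducesMem I (LinearMap.mulLeft k
          (∑ x ∈ s.image Prod.fst, monomial x (c (x, b)))) := by
        convert h.lower b using 1
        have hle : ∀ p ∈ insert (a, b) F, (b ≤ p.2 ↔ p.2 = b) := fun p hp =>
          ⟨fun hle => eq_of_le_of_degree_le hle (by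
            rcases Finset.mem_insert.mp hp with rfl | hp
            exacts [le_rfl, hmax p hp]), fun h => h.ge⟩
        have hinj : Set.InjOn Prod.fst (s : Set ((Fin n →₀ ℕ) × (Fin n →₀ ℕ))) := by
          intro p hp q hq hpq
          rw [Finset.mem_coe, Finset.mem_filter] at hp hq
          exact Prod.ext hpq (hp.2.trans hq.2.symm)
        rw [Finset.sum_image hinj, Finset.sum_filter]
        refine LinearMap.ext fun q => ?_
        rw [LinearMap.mulLeft_apply, Finset.sum_mul, LinearMap.sum_apply]
        refine Finset.sum_congr rfl fun p hp => ?_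
        simp only [hle p hp]
        split_ifs with h
        · rw [← h, tsub_self, weylMonomial, dividedPowerOp_zero, mul_one, smul_mulLeft,
            smul_monomial, smul_eq_mul, mul_one, LinearMap.mulLeft_apply]
        · simp
      exact hs.mulLeft_monomial (c := fun x => c (x, b)) a (by simp [s])
    have hred := htop.smul_reducedMonomial_mem
    have hI := inducesMem_weylMonomial_of_smul_reducedMonomial_mem hred hab
    have hJ := inducesMem_weylMonomial_of_smul_reducedMonomial_mem (hIJ _ _ hred) hab
    rw [Finset.sum_insert hp] at h ⊢
    refine hJ.add (ih (fun p hp => hF p (Finset.mem_insert_of_mem hp)) ?_)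
    simpa using h.sub hI

end Ideals

/-! ### The classification of two-sided ideals -/

section Classification

variable {k : Type*} [CommRing k] {n : ℕ} {K : PreAbstractSimplicialComplex (Fin n)}

/-- A two-sided ideal of `D(R)` is determined by the multiples of reduced monomials it contains. -/
theorem TwoSidedIdeal.le_of_smul_reducedMonomial_mem
    {I J : TwoSidedIdeal (diffOps k (FaceRing k K))}
    (hIJ : ∀ (c : k) (τ : Finset (Fin n)),
      c • reducedMonomial k K τ ∈ I → c • reducedMonomial k K τ ∈ J) : I ≤ J := by
  intro φ hφ
  obtain ⟨F, c, hF, hind⟩ := exists_isInducedBy_sum φ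
  exact hind.mem_iff.mpr (.of_smul_reducedMonomial_mem hIJ hF (hind.mem_iff.mp hφ))

theorem TwoSidedIdeal.algebra_smul_mem {A : Type*} [Ring A] [Algebra k A] (I : TwoSidedIdeal A)
    (c : k) {x : A} (h : x ∈ I) : c • x ∈ I := by
  rw [Algebra.smul_def]
  exact I.mul_mem_left _ _ h

end Classification

theorem mainTheorem1 {k : Type*} [CommRing k] [IsDomain k] {n : ℕ}
    (K : PreAbstractSimplicialComplex (Fin n)) :
    -- over a field, proper two-sided ideals are generated by reduced monomials
    (IsField k → ∀ I : TwoSidedIdeal (diffOps k (FaceRing k K)), I ≠ ⊤ →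
      ∃ S : Set (Finset (Fin n)), I = TwoSidedIdeal.span (reducedMonomial k K '' S)) ∧
    -- over a domain, they are generated by constant multiples of reduced monomials
    (∀ I : TwoSidedIdeal (diffOps k (FaceRing k K)), I ≠ ⊤ →
      ∃ S : Set (k × Finset (Fin n)),
        I = TwoSidedIdeal.span ((fun p => p.1 • reducedMonomial k K p.2) '' S)) ∧
    -- the principal ideal of an operator `x^a ∂^{(b)}` in `D(R)`
    (∀ (a b : Fin n →₀ ℕ) (θ : diffOps k (FaceRing k K)), IsInducedBy θ (weylMonomial k a b) →
      TwoSidedIdeal.span {θ} = TwoSidedIdeal.span {reducedMonomial k K a.support}) := by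
  refine ⟨fun hk I _ => ?_, fun I _ => ?_, fun a b θ hθ => ?_⟩
  · refine ⟨{τ | reducedMonomial k K τ ∈ I}, le_antisymm
      (TwoSidedIdeal.le_of_smul_reducedMonomial_mem fun c τ h => ?_)
      (TwoSidedIdeal.span_le.mpr ?_)⟩
    · rcases eq_or_ne c 0 with rfl | hc
      · rw [zero_smul]
        exact TwoSidedIdeal.zero_mem _
      · obtain ⟨d, hd⟩ := hk.mul_inv_cancel hc
        refine TwoSidedIdeal.algebra_smul_mem _ c (TwoSidedIdeal.subset_span ⟨τ, ?_, rfl⟩)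
        have := I.algebra_smul_mem d h
        rwa [smul_smul, mul_comm, hd, one_smul] at this
    · rintro _ ⟨τ, hτ, rfl⟩
      exact hτ
  · refine ⟨{p | p.1 • reducedMonomial k K p.2 ∈ I}, le_antisymm
      (TwoSidedIdeal.le_of_smul_reducedMonomial_mem fun c τ h =>
        TwoSidedIdeal.subset_span ⟨(c, τ), h, rfl⟩)
      (TwoSidedIdeal.span_le.mpr ?_)⟩
    rintro _ ⟨p, hp, rfl⟩
    exact hp
  · refine le_antisymm (TwoSidedIdeal.span_le.mpr ?_) (TwoSidedIdeal.span_le.mpr ?_)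
    · rw [Set.singleton_subset_iff, SetLike.mem_coe, hθ.mem_iff, ← one_smul k (weylMonomial k a b)]
      refine inducesMem_weylMonomial_of_smul_reducedMonomial_mem ?_ hθ.isAdmissible
      rw [one_smul]
      exact TwoSidedIdeal.subset_span rfl
    · rw [Set.singleton_subset_iff, SetLike.mem_coe, ← one_smul k (reducedMonomial k K a.support)]
      have hmem : θ ∈ TwoSidedIdeal.span {θ} := TwoSidedIdeal.subset_span (Set.mem_singleton θ)
      exact (hθ.mem_iff.mp hmem).mulLeft_of_weylMonomial.smul_reducedMonomial_mem
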